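/- Let $A$ be a finite set of items and let $\mathcal F$ be an antimonotonic family of subsets of $A$ (every subset of a member is a member). *Safe sets.* For $I\subseteq A$ and $U\subseteq I$ let $S_U:\{0,1\}^{I}\to\{0,1\}$ be the indicator that all coordinates in $U$ equal $1$. The frequencies of a non-empty data set $D$ (a finite multiset of subsets of $A$, read as points of $\{0,1\}^A$) are $\theta_U=\frac1{|D|}\sum_{z\in D}S_U(z)$, $U\in\mathcal F$. A set $C\subseteq A$ is *safe* if for all such frequencies $\theta$, every probability distribution $q$ on $\{0,1\}^C$ with $\mathbb E_q[S_U]=\theta_U$ for all $U\in\mathcal F$ with $U\subseteq C$ is the marginal on $C$ of a probability distribution $p$ on $\{0,1\}^A$ with $\mathbb E_p[S_U]=\theta_U$ for all $U\in\mathcal F$. *Neighbourhoods and ranks.* Let $G$ be the graph on $A$ in which $a\ne b$ are adjacent if and only if $\{a,b\}\in\mathcal F$. Let $N_C(x,r)$ be the set of the items reachable from $x$ by a path of $G$ with at most $r$ edges of which only the last item may belong to $C$. The rank of $x$ with respect to $C$ is the vector of length $|A|-1$ with entries $v_i=|C\cap(N_C(x,i)\setminus N_C(x,i-1))|$, $i=1,\dots,|A|-1$;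 ranks are compared lexicographically. *The algorithm.* The input is a set $B\subseteq A$. Start with $C:=B$. In each iteration let $V$ be the set of the items outside $C$ that are adjacent to an item of $C$. For $r=1,2,\dots$ compute $U_x:=N_C(x,r)\cap C$ for all $x\in V$; stop increasing $r$ as soon as some $U_x\notin\mathcal F$ (a violation), or as soon as no $U_x$ has changed from the previous radius. If there is no violation, the algorithm ends. Otherwise let $W=\{x\in V\mid U_x\notin\mathcal F\}$, let $v$ be the maximal rank with respect to $C$ of the items of $W$, let $Z$ be the set of the items of $W$ of rank $v$, replace $C$ by $C\cup Z$, and start the next iteration. **Theorem.** Consider any iteration of the algorithm, for any input $B$, in which a violation is found. Let $C$ be the current set at the start of this iteration and let $Z$ be the set that the iteration adds to $C$. Then $Z\subseteq Y$ for every safe set $Y\subseteq A$ with $C\subseteq Y$. -/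

import Mathlib

namespace ItemsetSafe

/-! ### Itemsets, data sets, frequencies and safe sets

Items are the elements of a finite type; an itemset is a `Finset` of items; a point of `{0,1}^I`
is a map `I → Bool`; a probability distribution on the finite set `{0,1}^I` is an element of
`stdSimplex ℝ (I → Bool)`. -/

/-- The itemset indicator function `S_U : {0,1}^I → {0,1}`. -/
def indic {I : Type*} [DecidableEq I] (U : Finset I) (z : I → Bool) : ℝ :=
  if ∀ a ∈ U, z a = true then 1 else 0

/-- The frequency of the itemset `U` in the data set `D` (a multiset of subsets of `A`): the mean
of `S_U` over the rows of `D`, a row being read as its 0-1 vector. -/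
noncomputable def freq {A : Type*} [DecidableEq A] (D : Multiset (Finset A)) (U : Finset A) : ℝ :=
  (D.map fun t => indic U fun a => decide (a ∈ t)).sum / (D.card : ℝ)

/-- The distribution `p` on `{0,1}^I` satisfies the frequencies `θ` for the family `F`:
the mean of `S_U` under `p` is `θ U` for all `U ∈ F`. -/
def Satisfies {I : Type*} [Fintype I] [DecidableEq I] (F : Finset (Finset I))
    (θ : Finset I → ℝ) (p : (I → Bool) → ℝ) : Prop :=
  ∀ U ∈ F, ∑ z, p z * indic U z = θ U

section

variable {A : Type*} [Fintype A] [DecidableEq A]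

/-- The itemset over `A` that corresponds to an itemset over the items of `C`. -/
def lift (C : Finset A) (U : Finset C) : Finset A :=
  U.map (Function.Embedding.subtype (· ∈ C))

/-- The projected family: the members of `F` that are contained in `C`, as itemsets over `C`. -/
def projFamily (C : Finset A) (F : Finset (Finset A)) : Finset (Finset C) :=
  Finset.univ.filter fun U => lift C U ∈ F

/-- The projected frequencies. -/
def projFreq (C : Finset A) (θ : Finset A → ℝ) : Finset C → ℝ :=
  fun U => θ (lift C U)

/-- The marginal on `C` of a distribution on `{0,1}^A`. -/
def marginal (C : Finset A) (p : (A → Bool) → ℝ) : (C → Bool) → ℝ :=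
  fun y => ∑ z ∈ Finset.univ.filter (fun z : A → Bool => (fun i : C => z i) = y), p z

/-- `C` is `θ`-safe: every distribution on `C` with the projected frequencies has an extension
to `A` with the frequencies `θ`. -/
def IsSafeFor (F : Finset (Finset A)) (θ : Finset A → ℝ) (C : Finset A) : Prop :=
  ∀ q ∈ stdSimplex ℝ (C → Bool), Satisfies (projFamily C F) (projFreq C θ) q →
    ∃ p ∈ stdSimplex ℝ (A → Bool), marginal C p = q ∧ Satisfies F θ p

/-- `C` is safe: it is `θ`-safe for all frequencies `θ` of (non-empty) data sets. -/
def IsSafe (F : Finset (Finset A)) (C : Finset A) : Prop :=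
  ∀ D : Multiset (Finset A), D ≠ 0 → IsSafeFor F (freq D) C

/-! ### The dependency graph, restricted neighbourhoods and ranks -/

/-- The dependency graph: two distinct items are adjacent if the pair belongs to `F`. -/
def depGraph (F : Finset (Finset A)) : SimpleGraph A where
  Adj a b := a ≠ b ∧ ({a, b} : Finset A) ∈ F
  symm := ⟨fun a b h => ⟨h.1.symm, by rw [Finset.pair_comm]; exact h.2⟩⟩
  loopless := ⟨fun _ h => h.1 rfl⟩

open scoped Classical in
/-- The restricted neighbourhood of `x` of radius `r`: the items reachable from `x` by a path with
at most `r` edges, only the last item of which may belong to `C`. -/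
noncomputable def nbhd (F : Finset (Finset A)) (C : Finset A) (x : A) (r : ℕ) : Finset A :=
  Finset.univ.filter fun y => ∃ P : (depGraph F).Walk x y,
    P.IsPath ∧ P.length ≤ r ∧ ∀ z ∈ P.support, z ∈ C → z = y

/-- The rank of `x` with respect to `C`, a vector of length `|A| - 1` in lexicographic order. The
entry at the 0-based index `i` counts the items of `C` at restricted distance `i + 1` from `x`. -/
noncomputable def rank (F : Finset (Finset A)) (C : Finset A) (x : A) :
    Lex (Fin (Fintype.card A - 1) → ℕ) :=
  toLex fun i => (C ∩ (nbhd F C x (i + 1) \ nbhd F C x i)).card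

/-! ### The search algorithm -/

open scoped Classical in
/-- The set `V` of the neighbours of `C`. -/
noncomputable def neighbours (F : Finset (Finset A)) (C : Finset A) : Finset A :=
  (Finset.univ.filter fun x => ∃ y ∈ C, (depGraph F).Adj x y) \ C

/-- The set `U_x` that is computed for `x ∈ V` when the search radius is `r`. -/
noncomputable def reach (F : Finset (Finset A)) (C : Finset A) (r : ℕ) (x : A) : Finset A :=
  nbhd F C x r ∩ C

/-- The set `W` of the violating neighbours at search radius `r`. -/
noncomputable def violating (F : Finset (Finset A)) (C : Finset A) (r : ℕ) : Finset A :=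
  (neighbours F C).filter fun x => reach F C r x ∉ F

/-- `InnerVisits F C r`: the inner loop, run for the set `C`, makes a pass with radius `r`. The
loop starts with `r = 1`; after a pass without violation it goes on with `r + 1`, unless no `U_x`
has changed since the pass before. For `r = 1` there is no earlier pass; comparing with
`reach F C 0 x`, which is empty for `x ∉ C`, says that the first assignment counts as a change. -/
inductive InnerVisits (F : Finset (Finset A)) (C : Finset A) : ℕ → Prop
  | start : InnerVisits F C 1
  | next (r : ℕ) : InnerVisits F C r → violating F C r = ∅ →
      (∃ x ∈ neighbours F C, reach F C r x ≠ reach F C (r - 1) x) → InnerVisits F C (r + 1)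

/-- The inner loop, run for the set `C`, finds a violation and breaks at radius `r`. -/
def BreaksAt (F : Finset (Finset A)) (C : Finset A) (r : ℕ) : Prop :=
  InnerVisits F C r ∧ (violating F C r).Nonempty

/-- The set `Z` of the violating items of maximal rank, for the search radius `r`. -/
noncomputable def added (F : Finset (Finset A)) (C : Finset A) (r : ℕ) : Finset A :=
  (violating F C r).filter fun x => ∀ y ∈ violating F C r, rank F C y ≤ rank F C x

/-- `OuterVisits F B C`: the algorithm with the input `B` starts some iteration of its outer loop
with the current set `C`. -/
inductive OuterVisits (F : Finset (Finset A)) (B : Finset A) : Finset A → Prop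
  | start : OuterVisits F B B
  | next (C : Finset A) (r : ℕ) : OuterVisits F B C → BreaksAt F C r →
      OuterVisits F B (C ∪ added F C r)

end

end ItemsetSafe

/-!
Two facts carry the proof.

*Safe sets have frontiers in the family.* Let `Y` be safe and `x ∉ Y`. The frontier of `x` is the
set `W` of the items of `Y` that are adjacent to the connected component `H` of `x` in the graph
with `Y` removed. If `W` is not empty, then `W ∈ F` (`mem_of_isSafe`). Suppose to the contrary
that `W ∉ F`, and consider the data set with one row for each `T ⊆ W`: the row `T`, with `H` added
if `T = W`. The edges inside `H` and between `H` and `W` are members of `F`, and in every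
distribution with the frequencies of the data these edges force that an item of `H` occurs
only together with all of `W`; since `H` occurs with positive probability, so does `W`. But a
distribution on `Y` can give the itemset `W` probability zero and still agree with the data:
give `T ⊆ W` a weight proportional to `1 - (-1)^(|W| + |T|)`. The signs cancel over the
supersets in `W` of any `U` not containing `W`, hence for all `U ∈ F`.

*Domination.* Suppose that `z ∉ C` violates, that `C ⊆ Y`, and that `z ∉ Y`. The frontier of `z`
is in `F`, so it does not contain all the items of `C` within the search radius: some such item is
reached only through `Y \ C`. Let `y ∈ Y \ C` be the first item of `Y` on a shortest path to it.
The frontier is a member of `F`, hence a clique, and `y` belongs to it. Therefore `y` is at least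
as close as `z` to every item of `C`: an item of the frontier is adjacent to `y`, and any other one
is reached through an item of the frontier, which costs `z` at least one step and `y` at most one.
It follows that `y` violates as well, and its rank is strictly larger
(`exists_violating_rank_lt`), so `z` is not of maximal rank.
-/

namespace ItemsetSafe

variable {A : Type*}

/-! ### Items reachable outside a set -/

/-- `c` is adjacent to the connected component of `x` in the dependency graph with `Y` removed.
The component is encoded by the reflexive transitive closure of the steps that end outside `Y`. -/
def Linked [DecidableEq A] (F : Finset (Finset A)) (Y : Finset A) (x c : A) : Prop :=
  ∃ h, Relation.ReflTransGen (fun a b => (depGraph F).Adj a b ∧ b ∉ Y) x h ∧ (depGraph F).Adj h c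

/-- The restricted neighbourhood may be computed with walks instead of paths. -/
lemma mem_nbhd_iff [Fintype A] [DecidableEq A] {F : Finset (Finset A)}
    {C : Finset A} {x y : A} {r : ℕ} :
    y ∈ nbhd F C x r ↔ ∃ P : (depGraph F).Walk x y, P.length ≤ r ∧
      ∀ z ∈ P.support, z ∈ C → z = y := by
  classical
  simp only [nbhd, Finset.mem_filter, Finset.mem_univ, true_and]
  constructor
  · rintro ⟨P, -, h⟩
    exact ⟨P, h⟩
  · rintro ⟨P, hl, hs⟩
    exact ⟨P.bypass, P.bypass_isPath, P.length_bypass_le_length.trans hl,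
      fun z hz => hs z (P.support_bypass_subset_support hz)⟩

lemma nbhd_mono [Fintype A] [DecidableEq A] {F : Finset (Finset A)}
    {C : Finset A} {x : A} {i j : ℕ} (h : i ≤ j) :
    nbhd F C x i ⊆ nbhd F C x j := by
  intro y hy
  obtain ⟨P, hl, hs⟩ := mem_nbhd_iff.1 hy
  exact mem_nbhd_iff.2 ⟨P, hl.trans h, hs⟩

lemma inter_nbhd_zero [Fintype A] [DecidableEq A] {F : Finset (Finset A)}
    {C : Finset A} {x : A} (hx : x ∉ C) :
    C ∩ nbhd F C x 0 = ∅ := by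
  rw [Finset.eq_empty_iff_forall_notMem]
  intro c hc
  rw [Finset.mem_inter] at hc
  obtain ⟨P, hl, -⟩ := mem_nbhd_iff.1 hc.2
  obtain rfl := SimpleGraph.Walk.eq_of_length_eq_zero (Nat.le_zero.1 hl)
  exact hx hc.1

/-- A path to `c` whose interior avoids `C` either shows that `c` is adjacent to the component of
the start outside `Y`, or it meets `Y \ C`, for the first time in an item adjacent to it. -/
lemma linked_or_exists_shorter [DecidableEq A] {F : Finset (Finset A)} {C Y : Finset A} {x h c : A}
    (hc : c ∈ Y) (hh : h ∉ Y)
    (hx : Relation.ReflTransGen (fun a b => (depGraph F).Adj a b ∧ b ∉ Y) x h)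
    (P : (depGraph F).Walk h c) (hP : ∀ z ∈ P.support, z ∈ C → z = c) :
    Linked F Y x c ∨ ∃ y ∈ Y, y ∉ C ∧ Linked F Y x y ∧
      ∃ Q : (depGraph F).Walk y c, Q.length < P.length ∧ ∀ z ∈ Q.support, z ∈ C → z = c := by
  induction P with
  | nil => exact absurd hc hh
  | @cons u v w hadj P ih =>
    have hP' : ∀ z ∈ P.support, z ∈ C → z = w := fun z hz => hP z (by simp [hz])
    by_cases hvC : v ∈ C
    · obtain rfl := hP' v P.start_mem_support hvC
      exact Or.inl ⟨u, hx, hadj⟩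
    by_cases hvY : v ∈ Y
    · exact Or.inr ⟨v, hvY, hvC, ⟨u, hx, hadj⟩, P, by simp, hP'⟩
    · rcases ih hc hvY (hx.tail ⟨hadj, hvY⟩) hP' with h1 | ⟨y, hy, hyC, hl, Q, hQ, hQs⟩
      · exact Or.inl h1
      · exact Or.inr ⟨y, hy, hyC, hl, Q, by simp; omega, hQs⟩

/-! ### Frontiers of safe sets -/

/-- The frequencies of the data set with a row for each `T ⊆ W`, namely `T` itself, except that
the row of `W` is `W ∪ H`. -/
lemma freq_rows [DecidableEq A] (W H U : Finset A) :
    freq (W.powerset.val.map fun T => if T = W then T ∪ H else T) U =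
      ∑ T ∈ W.powerset, (if U ⊆ (if T = W then T ∪ H else T) then (1 : ℝ) else 0) / 2 ^ W.card := by
  rw [freq, Multiset.map_map, Multiset.card_map, Finset.card_val, Finset.card_powerset,
    ← Finset.sum_div]
  push_cast
  congr 1
  apply Finset.sum_congr rfl
  intro T _
  simp [indic, Finset.subset_iff]

lemma freq_rows_of_mem [DecidableEq A] {W H U : Finset A} {h : A} (hWH : h ∉ W) (hU : h ∈ U)
    (hUs : U ⊆ W ∪ H) :
    freq (W.powerset.val.map fun T => if T = W then T ∪ H else T) U = 1 / 2 ^ W.card := by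
  rw [freq_rows, Finset.sum_eq_single W]
  · simp [hUs]
  · intro T hT hne
    have : ¬ U ⊆ T := fun hs => hWH (Finset.mem_powerset.1 hT (hs hU))
    simp [hne, this]
  · simp

lemma freq_rows_of_disjoint [DecidableEq A] {W H U : Finset A} (hU : Disjoint U H) :
    freq (W.powerset.val.map fun T => if T = W then T ∪ H else T) U =
      ∑ T ∈ W.powerset, (if U ⊆ T then (1 : ℝ) else 0) / 2 ^ W.card := by
  rw [freq_rows]
  refine Finset.sum_congr rfl fun T _ => ?_
  have : U ⊆ (if T = W then T ∪ H else T) ↔ U ⊆ T := by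
    split_ifs
    · exact ⟨fun h => hU.left_le_of_le_sup_right h, fun h => h.trans Finset.subset_union_left⟩
    · rfl
  simp only [this]

lemma sum_sign_superset_eq_zero [DecidableEq A] {W U : Finset A} (h : ¬ W ⊆ U) :
    ∑ T ∈ W.powerset, (-1 : ℝ) ^ T.card * (if U ⊆ T then 1 else 0) = 0 := by
  obtain ⟨a, haW, haU⟩ := Finset.not_subset.1 h
  -- Adding `a` to `T` changes the sign and keeps the condition `U ⊆ T`.
  rw [← Finset.insert_erase haW, Finset.sum_powerset_insert (Finset.notMem_erase a W),
    ← Finset.sum_add_distrib]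
  refine Finset.sum_eq_zero fun T hT => ?_
  have haT : a ∉ T := fun h => Finset.notMem_erase a W (Finset.mem_powerset.1 hT h)
  have hiff : U ⊆ insert a T ↔ U ⊆ T := by
    rw [Finset.subset_insert_iff, Finset.erase_eq_of_notMem haU]
  rw [Finset.card_insert_of_notMem haT, pow_succ]
  simp only [hiff]
  ring

/-- The weight of the subset `T` of `W` in the distribution that avoids the full set `W`. -/
noncomputable def parityWeight (W T : Finset A) : ℝ :=
  (1 - (-1) ^ W.card * (-1) ^ T.card) / 2 ^ W.card

lemma parityWeight_nonneg (W T : Finset A) : 0 ≤ parityWeight W T := by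
  rw [parityWeight, ← pow_add]
  rcases neg_one_pow_eq_or ℝ (W.card + T.card) with h | h <;> rw [h] <;> positivity

lemma parityWeight_self (W : Finset A) : parityWeight W W = 0 := by
  simp [parityWeight, ← mul_pow]

lemma sum_parityWeight [DecidableEq A] {W U : Finset A} (h : ¬ W ⊆ U) :
    ∑ T ∈ W.powerset, parityWeight W T * (if U ⊆ T then 1 else 0) =
      ∑ T ∈ W.powerset, (if U ⊆ T then (1 : ℝ) else 0) / 2 ^ W.card := by
  have h0 := congrArg (fun s => -((-1 : ℝ) ^ W.card / 2 ^ W.card) * s) (sum_sign_superset_eq_zero h)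
  simp only [Finset.mul_sum, mul_zero] at h0
  refine sub_eq_zero.1 (Eq.trans ?_ h0)
  rw [← Finset.sum_sub_distrib]
  refine Finset.sum_congr rfl fun T _ => ?_
  rw [parityWeight]
  ring

/-- The distribution on `{0,1}^Y` that gives the point `T ⊆ W` the weight `parityWeight W T`. -/
noncomputable def parityDist [DecidableEq A] (Y W : Finset A) (y : Y → Bool) : ℝ :=
  ∑ T ∈ W.powerset, if y = (fun i : Y => decide ((i : A) ∈ T)) then parityWeight W T else 0

lemma sum_parityDist_mul [DecidableEq A] (Y W : Finset A) (f : (Y → Bool) → ℝ) :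
    ∑ y, parityDist Y W y * f y =
      ∑ T ∈ W.powerset, parityWeight W T * f (fun i : Y => decide ((i : A) ∈ T)) := by
  simp only [parityDist, Finset.sum_mul]
  rw [Finset.sum_comm]
  refine Finset.sum_congr rfl fun T _ => ?_
  simp [ite_mul]

lemma parityDist_mem_stdSimplex [DecidableEq A] {Y W : Finset A} (hW : W.Nonempty) :
    parityDist Y W ∈ stdSimplex ℝ (Y → Bool) := by
  refine ⟨fun y => Finset.sum_nonneg fun T _ => ?_, ?_⟩
  · split_ifs
    exacts [parityWeight_nonneg W T, le_rfl]
  · have h1 := sum_parityDist_mul Y W fun _ => 1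
    have h2 := sum_parityWeight (W := W) (U := ∅) (by simpa using hW.ne_empty)
    simp only [Finset.empty_subset, if_true] at h2
    simp only [mul_one] at h1 h2
    rw [h1, h2, Finset.sum_const, Finset.card_powerset, nsmul_eq_mul]
    push_cast
    field_simp

lemma indic_decide_mem [DecidableEq A] {Y : Finset A} (U : Finset Y) (T : Finset A) :
    indic U (fun i : Y => decide ((i : A) ∈ T)) = if lift Y U ⊆ T then 1 else 0 := by
  have : (∀ a ∈ U, decide ((a : A) ∈ T) = true) ↔ lift Y U ⊆ T := by
    simp [lift, Finset.subset_iff]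
  simp only [indic, this]

lemma lift_subset {Y : Finset A} (U : Finset Y) : lift Y U ⊆ Y := by
  intro a ha
  obtain ⟨b, -, rfl⟩ := Finset.mem_map.1 ha
  exact b.2

lemma parityDist_satisfies [Fintype A] [DecidableEq A] {F : Finset (Finset A)}
    (hF : IsLowerSet (F : Set (Finset A)))
    {Y W H : Finset A} (hW : W ∉ F) (hYH : Disjoint Y H) :
    Satisfies (projFamily Y F)
      (projFreq Y (freq (W.powerset.val.map fun T => if T = W then T ∪ H else T)))
      (parityDist Y W) := by
  intro U hU
  have hUF : lift Y U ∈ F := by simpa [projFamily] using hU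
  have hWU : ¬ W ⊆ lift Y U := fun h => hW (hF h hUF)
  rw [sum_parityDist_mul, projFreq, freq_rows_of_disjoint (hYH.mono_left (lift_subset U)),
    ← sum_parityWeight hWU]
  simp only [indic_decide_mem]

lemma parityDist_eq_zero [DecidableEq A] {Y W : Finset A} (hWY : W ⊆ Y) {y : Y → Bool}
    (hy : ∀ c (hc : c ∈ W), y ⟨c, hWY hc⟩ = true) : parityDist Y W y = 0 := by
  refine Finset.sum_eq_zero fun T hT => ?_
  split_ifs with h
  · have hWT : W ⊆ T := fun c hc => by
      have := hy c hc
      rw [h] at this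
      simpa using this
    rw [(Finset.mem_powerset.1 hT).antisymm hWT, parityWeight_self]
  · rfl

/-- If `{a}` and `{a, b}` have the same probability, then almost surely `a` occurs only together
with `b`. -/
lemma apply_eq_true_of_prob_eq [Fintype A] [DecidableEq A] {p : (A → Bool) → ℝ}
    (hp : ∀ z, 0 ≤ p z) {a b : A}
    (h : ∑ z, p z * indic {a} z = ∑ z, p z * indic {a, b} z) {z : A → Bool} (hz : p z ≠ 0)
    (ha : z a = true) : z b = true := by
  have hle : ∀ z ∈ Finset.univ, p z * indic {a, b} z ≤ p z * indic {a} z := fun z _ => by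
    refine mul_le_mul_of_nonneg_left ?_ (hp z)
    simp only [indic]
    split_ifs with h1 h2 <;> simp_all
  have := (Finset.sum_eq_sum_iff_of_le hle).1 h.symm z (Finset.mem_univ z)
  by_contra hb
  simp [indic, ha, hb] at this
  exact hz this.symm

lemma not_mem_of_reachable [DecidableEq A] {F : Finset (Finset A)}
    {Y : Finset A} {x h : A} (hx : x ∉ Y)
    (hh : Relation.ReflTransGen (fun a b => (depGraph F).Adj a b ∧ b ∉ Y) x h) : h ∉ Y := by
  cases hh with
  | refl => exact hx
  | tail _ h => exact h.2

/-- If `Y` is safe, then items of `Y` that are adjacent to a common connected component outside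
`Y` form a member of the family. -/
lemma mem_of_isSafe [Fintype A] [DecidableEq A] {F : Finset (Finset A)}
    (hF : IsLowerSet (F : Set (Finset A)))
    {Y W : Finset A} (hY : IsSafe F Y) {x : A} (hx : x ∉ Y) (hW : W.Nonempty) (hWY : W ⊆ Y)
    (hl : ∀ c ∈ W, Linked F Y x c) : W ∈ F := by
  classical
  by_contra hWF
  set R : A → A → Prop := fun a b => (depGraph F).Adj a b ∧ b ∉ Y with hR
  set H : Finset A := Finset.univ.filter fun h => Relation.ReflTransGen R x h with hH
  have hHY : ∀ h ∈ H, h ∉ Y := fun h hh => not_mem_of_reachable hx (Finset.mem_filter.1 hh).2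
  have hYH : Disjoint Y H := Finset.disjoint_left.2 fun a ha hh => hHY a hh ha
  obtain ⟨p, hp, hpq, hpF⟩ := hY (W.powerset.val.map fun T => if T = W then T ∪ H else T)
    (fun h => by
      have := congrArg Multiset.card h
      simp at this)
    _ (parityDist_mem_stdSimplex hW) (parityDist_satisfies hF hWF hYH)
  have hprob : ∀ U ∈ F, ∀ h ∈ H, h ∈ U → U ⊆ W ∪ H →
      ∑ z, p z * indic U z = 1 / 2 ^ W.card := fun U hU h hh hhU hUs => by
    rw [hpF U hU, freq_rows_of_mem (fun hw => hHY h hh (hWY hw)) hhU hUs]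
  have hstep : ∀ a ∈ H, ∀ b ∈ W ∪ H, (depGraph F).Adj a b →
      ∀ z, p z ≠ 0 → z a = true → z b = true := fun a ha b hb hab z hz hza => by
    refine apply_eq_true_of_prob_eq hp.1 ?_ hz hza
    rw [hprob {a} (hF (by simp) hab.2) a ha (by simp) (by simp [ha]),
      hprob {a, b} hab.2 a ha (by simp)
        (Finset.insert_subset (by simp [ha]) (Finset.singleton_subset_iff.2 hb))]
  have hxH : x ∈ H := by simp [hH, Relation.ReflTransGen.refl]
  -- The singleton `{x}` lies in `F` because the component of `x` has an edge at `x`.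
  have hxF : ({x} : Finset A) ∈ F := by
    obtain ⟨c, hc⟩ := hW
    obtain ⟨h, hxh, hhc⟩ := hl c hc
    rcases hxh.cases_head with rfl | ⟨b, hb, -⟩
    · exact hF (by simp) hhc.2
    · exact hF (by simp) hb.1.2
  obtain ⟨z, hz, hzx⟩ : ∃ z, p z ≠ 0 ∧ z x = true := by
    by_contra! hcon
    have h0 : ∑ z, p z * indic {x} z = 0 := Finset.sum_eq_zero fun z _ => by
      by_cases hz : p z = 0
      · simp [hz]
      · simp [indic, hcon z hz]
    rw [hprob {x} hxF x hxH (by simp) (by simp [hxH])] at h0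
    exact absurd h0 (by positivity)
  have hzH : ∀ h, Relation.ReflTransGen R x h → z h = true := fun h hh => by
    induction hh with
    | refl => exact hzx
    | @tail b c hb hbc ih =>
      exact hstep b (by simp [hH, hb]) c
        (Finset.mem_union_right _ (by simpa [hH] using hb.tail hbc)) hbc.1 z hz ih
  have hzW : ∀ c ∈ W, z c = true := fun c hc => by
    obtain ⟨h, hxh, hhc⟩ := hl c hc
    exact hstep h (by simpa [hH] using hxh) c (Finset.mem_union_left _ hc) hhc z hz (hzH h hxh)
  have hq := congrFun hpq fun i : Y => z i
  rw [parityDist_eq_zero hWY fun c hc => hzW c hc, marginal] at hq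
  exact hz ((Finset.sum_eq_zero_iff_of_nonneg fun z _ => hp.1 z).1 hq z (by simp))

/-! ### Comparing ranks -/

/-- If all items of `C` are at least as close to `y` as to `x`, and within some radius `y` reaches
more of them, then `y` has the larger rank. -/
lemma rank_lt_rank [Fintype A] [DecidableEq A] {F : Finset (Finset A)}
    {C : Finset A} {x y : A} (hx : x ∉ C) (hy : y ∉ C)
    (hle : ∀ i, C ∩ nbhd F C x i ⊆ C ∩ nbhd F C y i)
    (hne : ∃ i < Fintype.card A, C ∩ nbhd F C x i ≠ C ∩ nbhd F C y i) :
    rank F C x < rank F C y := by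
  classical
  have hex : ∃ i, C ∩ nbhd F C x i ≠ C ∩ nbhd F C y i := hne.imp fun _ h => h.2
  obtain ⟨k, hk⟩ : ∃ k, Nat.find hex = k + 1 := Nat.exists_eq_succ_of_ne_zero fun h0 => by
    have := Nat.find_spec hex
    rw [h0, inter_nbhd_zero hx, inter_nbhd_zero hy] at this
    exact this rfl
  have hmin : ∀ i ≤ k, C ∩ nbhd F C x i = C ∩ nbhd F C y i := fun i hi => by
    by_contra h
    have := Nat.find_min' hex h
    omega
  have hk1 : C ∩ nbhd F C x (k + 1) ⊂ C ∩ nbhd F C y (k + 1) :=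
    (hle _).ssubset_of_ne (hk ▸ Nat.find_spec hex)
  have hkA : k < Fintype.card A - 1 := by
    obtain ⟨i, hi, hne⟩ := hne
    have := Nat.find_min' hex hne
    omega
  have hsplit : ∀ u i, (C ∩ (nbhd F C u (i + 1) \ nbhd F C u i)).card =
      (C ∩ nbhd F C u (i + 1)).card - (C ∩ nbhd F C u i).card := fun u i => by
    rw [← Finset.inf_eq_inter, inf_sdiff_distrib_left, Finset.inf_eq_inter, Finset.inf_eq_inter,
      Finset.card_sdiff_of_subset
      (Finset.inter_subset_inter le_rfl (nbhd_mono i.le_succ))]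
  refine ⟨⟨k, hkA⟩, fun j hj => ?_, ?_⟩
  · have hj' : (j : ℕ) < k := hj
    change (C ∩ (nbhd F C x (j + 1) \ nbhd F C x j)).card =
      (C ∩ (nbhd F C y (j + 1) \ nbhd F C y j)).card
    rw [hsplit, hsplit, hmin _ hj', hmin _ hj'.le]
  · change (C ∩ (nbhd F C x (k + 1) \ nbhd F C x k)).card <
      (C ∩ (nbhd F C y (k + 1) \ nbhd F C y k)).card
    rw [hsplit, hsplit, hmin k le_rfl]
    have h1 := Finset.card_lt_card hk1
    have h2 := Finset.card_le_card (Finset.inter_subset_inter (le_refl C)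
      (nbhd_mono (F := F) (C := C) (x := x) (Nat.le_add_right k 1)))
    rw [hmin k le_rfl] at h2
    omega

/-- A violating item outside a safe set `Y ⊇ C` is beaten by a violating item of `Y \ C`. -/
lemma exists_violating_rank_lt [Fintype A] [DecidableEq A] {F : Finset (Finset A)}
    (hF : IsLowerSet (F : Set (Finset A)))
    {C Y : Finset A} {r : ℕ} (hY : IsSafe F Y) (hCY : C ⊆ Y) {x : A} (hxY : x ∉ Y)
    (hx : x ∈ violating F C r) : ∃ y ∈ violating F C r, rank F C x < rank F C y := by
  classical
  obtain ⟨hxV, hxF⟩ := Finset.mem_filter.1 hx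
  have hxC : x ∉ C := fun h => hxY (hCY h)
  obtain ⟨c₁, hc₁, hxc₁⟩ : ∃ c ∈ C, (depGraph F).Adj x c := by
    simpa [neighbours, hxC] using hxV
  set K : Finset A := Y.filter fun c => Linked F Y x c with hK
  have hc₁K : c₁ ∈ K := Finset.mem_filter.2 ⟨hCY hc₁, x, .refl, hxc₁⟩
  have hKF : K ∈ F := mem_of_isSafe hF hY hxY ⟨c₁, hc₁K⟩ (Finset.filter_subset _ _)
    fun c hc => (Finset.mem_filter.1 hc).2
  have hclique : ∀ a ∈ K, ∀ b ∈ K, a ≠ b → (depGraph F).Adj a b := fun a ha b hb hab =>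
    ⟨hab, hF (Finset.insert_subset ha (Finset.singleton_subset_iff.2 hb)) hKF⟩
  obtain ⟨c₀, hc₀, hc₀K⟩ := Finset.not_subset.1 fun h : reach F C r x ⊆ K => hxF (hF h hKF)
  obtain ⟨hc₀r, hc₀C⟩ := Finset.mem_inter.1 hc₀
  have hex : ∃ i, c₀ ∈ nbhd F C x i := ⟨r, hc₀r⟩
  -- A shortest path to `c₀`, so that the rest of it shows `y` to be strictly closer to `c₀`.
  obtain ⟨P, hPp, hPl, hPs⟩ := (Finset.mem_filter.1 (Nat.find_spec hex)).2
  have hlen : Nat.find hex = P.length :=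
    (Nat.find_min' hex (mem_nbhd_iff.2 ⟨P, le_rfl, hPs⟩)).antisymm hPl
  rcases linked_or_exists_shorter (hCY hc₀C) hxY .refl P hPs with
    hl | ⟨y, hyY, hyC, hyl, Q, hQl, hQs⟩
  · exact absurd (Finset.mem_filter.2 ⟨hCY hc₀C, hl⟩) hc₀K
  have hyK : y ∈ K := Finset.mem_filter.2 ⟨hyY, hyl⟩
  have hle : ∀ i, C ∩ nbhd F C x i ⊆ C ∩ nbhd F C y i := fun i c hc => by
    obtain ⟨hcC, hci⟩ := Finset.mem_inter.1 hc
    obtain ⟨P', hP'l, hP's⟩ := mem_nbhd_iff.1 hci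
    refine Finset.mem_inter.2 ⟨hcC, mem_nbhd_iff.2 ?_⟩
    rcases linked_or_exists_shorter (hCY hcC) hxY .refl P' hP's with
      hl | ⟨y', hy'Y, hy'C, hy'l, Q', hQ'l, hQ's⟩
    · have hyc : (depGraph F).Adj y c := hclique y hyK c (Finset.mem_filter.2 ⟨hCY hcC, hl⟩)
        fun h => hyC (h ▸ hcC)
      have hi : 1 ≤ i := Nat.one_le_iff_ne_zero.2 fun h0 => by
        rw [h0, inter_nbhd_zero hxC] at hc
        simp at hc
      exact ⟨hyc.toWalk, by simpa using hi, by simp [hyC]⟩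
    · by_cases hyy : y = y'
      · subst hyy
        exact ⟨Q', by omega, hQ's⟩
      · have hadj := hclique y hyK y' (Finset.mem_filter.2 ⟨hy'Y, hy'l⟩) hyy
        refine ⟨Q'.cons hadj, by simp; omega, fun z hz hzC => ?_⟩
        rcases List.mem_cons.1 (SimpleGraph.Walk.support_cons hadj Q' ▸ hz) with rfl | hz
        · exact absurd hzC hyC
        · exact hQ's z hz hzC
  refine ⟨y, Finset.mem_filter.2 ⟨?_, fun h => hxF (hF ?_ h)⟩, rank_lt_rank hxC hyC hle ?_⟩
  · have : (depGraph F).Adj y c₁ := hclique y hyK c₁ hc₁K fun h => hyC (h ▸ hc₁)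
    simp only [neighbours, Finset.mem_sdiff, Finset.mem_filter, Finset.mem_univ, true_and]
    exact ⟨⟨c₁, hc₁, this⟩, hyC⟩
  · have := hle r
    rwa [Finset.inter_comm C, Finset.inter_comm C] at this
  · refine ⟨Q.length, hQl.trans hPp.length_lt, fun h => ?_⟩
    have h1 : c₀ ∈ C ∩ nbhd F C y Q.length :=
      Finset.mem_inter.2 ⟨hc₀C, mem_nbhd_iff.2 ⟨Q, le_rfl, hQs⟩⟩
    rw [← h] at h1
    have := Nat.find_min' hex (Finset.mem_inter.1 h1).2
    omega

end ItemsetSafe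

theorem theorem6 {A : Type*} [Fintype A] [DecidableEq A] (F : Finset (Finset A))
    (hF : IsLowerSet (F : Set (Finset A))) (B C : Finset A)
    (hC : ItemsetSafe.OuterVisits F B C) (r : ℕ) (hr : ItemsetSafe.BreaksAt F C r)
    (Y : Finset A) (hY : ItemsetSafe.IsSafe F Y) (hCY : C ⊆ Y) :
    ItemsetSafe.added F C r ⊆ Y := by
  intro x hx
  obtain ⟨hxW, hmax⟩ := Finset.mem_filter.1 hx
  by_contra hxY
  obtain ⟨y, hyW, hlt⟩ := ItemsetSafe.exists_violating_rank_lt hF hY hCY hxY hxW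
  exact (hmax y hyW).not_gt hlt
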